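/- Let $k$ be a field, let $A$ be a finite dimensional self-injective $k$-algebra, and let $A\text{-mod}$ be the category of finitely generated left $A$-modules. A map of $A$-modules is called projective if it factors through a finitely generated projective module, and $A\text{-stab}$ denotes the stable category: it has the same objects as $A\text{-mod}$, and $\operatorname{Hom}_{A\text{-stab}}(M,N)$ is the quotient of $\operatorname{Hom}_A(M,N)$ by the subspace of projective maps. Write $M\sim N$ if $M$ and $N$ are isomorphic in $A\text{-stab}$. Let $\mathcal S$ be a finite set of indecomposable finitely generated $A$-modules such that, for $S,T\in\mathcal S$, the $k$-vector space $\operatorname{Hom}_{A\text{-stab}}(S,T)$ is isomorphic to $k$ if $S=T$ and is $0$ if $S\neq T$. Let $\operatorname{add}(\mathcal S)$ be the class of $A$-modules isomorphic to finite direct sums of members of $\mathcal S$. An $A$-module $M$ is called filtrable if it has a finite filtration by submodules $0=M_r\subseteq M_{r-1}\subseteq\cdots\subseteq M_0=M$ with $M_i/M_{i+1}\in\operatorname{add}(\mathcal S)$ for $0\le i\le r-1$. A filtrable module $M$ is said to have no projective remainder if there is no direct sum decomposition $M=N\oplus P$ with $P\neq 0$ projective and $N$ filtrable. Proposition. Let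 $M_1$ and $M_2$ be two filtrable $A$-modules with no projective remainder. If $M_1\sim M_2$, then $M_1\simeq M_2$ as $A$-modules. -/

import Mathlib

namespace StableModule

universe u v w w₁ w₂ w₃

section StableCategory

variable (k : Type u) (A : Type v) [Field k] [Ring A] [Algebra k A]

/-- A homomorphism of `A`-modules is projective if it factors through a finitely generated
projective `A`-module. (Every finitely generated `A`-module has a copy in the universe of `A`,
so nothing is lost by taking the intermediate module there.) -/
def IsProjectiveMap {M : Type w₁} {N : Type w₂} [AddCommGroup M] [Module A M]
    [AddCommGroup N] [Module A N] (f : M →ₗ[A] N) : Prop :=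
  ∃ (P : Type v) (_ : AddCommGroup P) (_ : Module A P) (a : M →ₗ[A] P) (b : P →ₗ[A] N),
    Module.Finite A P ∧ Module.Projective A P ∧ f = b ∘ₗ a

variable (M : Type w₁) (N : Type w₂) [AddCommGroup M] [Module k M] [Module A M]
  [IsScalarTower k A M] [AddCommGroup N] [Module k N] [Module A N] [IsScalarTower k A N]

/-- The `k`-subspace of projective maps in `Hom_A(M, N)`. -/
def projectiveMaps : Submodule k (M →ₗ[A] N) where
  carrier := {f | IsProjectiveMap A f}
  zero_mem' := ⟨PUnit, inferInstance, inferInstance, 0, 0, inferInstance, inferInstance, by simp⟩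
  add_mem' := by
    rintro f g ⟨P, _, _, a, b, hP, hP', rfl⟩ ⟨Q, _, _, c, d, hQ, hQ', rfl⟩
    exact ⟨P × Q, inferInstance, inferInstance, a.prod c, b.coprod d, inferInstance,
      inferInstance, by ext x; simp⟩
  smul_mem' := by
    rintro r f ⟨P, _, _, a, b, hP, hP', rfl⟩
    exact ⟨P, inferInstance, inferInstance, a, r • b, hP, hP', by ext x; simp⟩

/-- The morphisms `Hom_{A-stab}(M, N)` of the stable category: `A`-linear maps modulo
projective maps. -/
abbrev StableHom : Type (max w₁ w₂) := (M →ₗ[A] N) ⧸ projectiveMaps k A M N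

end StableCategory

section Composition

variable {k : Type u} {A : Type v} [Field k] [Ring A] [Algebra k A]
  {M : Type w₁} {N : Type w₂} {L : Type w₃}
  [AddCommGroup M] [Module k M] [Module A M] [IsScalarTower k A M]
  [AddCommGroup N] [Module k N] [Module A N] [IsScalarTower k A N]
  [AddCommGroup L] [Module k L] [Module A L] [IsScalarTower k A L]

/-- Composition in the stable category, induced by composition of linear maps. -/
def StableHom.comp (ψ : StableHom k A N L) (φ : StableHom k A M N) : StableHom k A M L :=
  Quotient.map₂ (fun (g : N →ₗ[A] L) (f : M →ₗ[A] N) => g ∘ₗ f) (by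
    intro g g' hg f f' hf
    have hg := (Submodule.quotientRel_def (projectiveMaps k A N L)).1 hg
    have hf := (Submodule.quotientRel_def (projectiveMaps k A M N)).1 hf
    refine (Submodule.quotientRel_def (projectiveMaps k A M L)).2 ?_
    obtain ⟨P, _, _, a, b, hP, hP', hab⟩ := hg
    obtain ⟨Q, _, _, c, d, hQ, hQ', hcd⟩ := hf
    have e : g ∘ₗ f - g' ∘ₗ f' = (g - g') ∘ₗ f + g' ∘ₗ (f - f') := by
      ext x; simp
    rw [e, hab, hcd]
    exact add_mem (S := Submodule k (M →ₗ[A] L))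
      (show _ ∈ projectiveMaps k A M L from ⟨P, _, _, a ∘ₗ f, b, hP, hP', rfl⟩)
      (show _ ∈ projectiveMaps k A M L from ⟨Q, _, _, c, g' ∘ₗ d, hQ, hQ', rfl⟩)) ψ φ

variable (k A M) in
/-- The identity morphism of `M` in the stable category. -/
def StableHom.id : StableHom k A M M := Submodule.Quotient.mk LinearMap.id

variable (k A M N) in
/-- `M ∼ N`: the modules `M` and `N` are isomorphic in the stable category. -/
def StablyIsomorphic : Prop :=
  ∃ (φ : StableHom k A M N) (ψ : StableHom k A N M),
    ψ.comp φ = StableHom.id k A M ∧ φ.comp ψ = StableHom.id k A N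

end Composition

section Filtrations

variable (A : Type v) [Ring A]

/-- A module is indecomposable if it is nonzero and is not the direct sum of two nonzero
submodules. -/
def IsIndecomposable (M : Type w) [AddCommGroup M] [Module A M] : Prop :=
  Nontrivial M ∧ ∀ P Q : Submodule A M, IsCompl P Q → P = ⊥ ∨ Q = ⊥

variable {ι : Type*} (S : ι → Type w) [∀ i, AddCommGroup (S i)] [∀ i, Module A (S i)]

/-- `M` is in `add(S)`: it is isomorphic to a finite direct sum of members of the family `S`
(repetitions and the empty sum being allowed). -/
def InAdd (M : Type w₁) [AddCommGroup M] [Module A M] : Prop :=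
  ∃ (n : ℕ) (t : Fin n → ι), Nonempty (M ≃ₗ[A] ((j : Fin n) → S (t j)))

/-- `0 = F r ⊆ F (r-1) ⊆ ⋯ ⊆ F 0 = M` is an `S`-filtration: every quotient `F i / F (i+1)` with
`0 ≤ i ≤ r - 1` is in `add(S)`. The values of `F` beyond `r` are irrelevant. -/
structure IsSFiltration (M : Type w₁) [AddCommGroup M] [Module A M] (r : ℕ)
    (F : ℕ → Submodule A M) : Prop where
  top : F 0 = ⊤
  bot : F r = ⊥
  le : ∀ i < r, F (i + 1) ≤ F i
  layer : ∀ i < r, InAdd A S (F i ⧸ (F (i + 1)).submoduleOf (F i))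

/-- `M` is filtrable if it admits an `S`-filtration. -/
def Filtrable (M : Type w₁) [AddCommGroup M] [Module A M] : Prop :=
  ∃ (r : ℕ) (F : ℕ → Submodule A M), IsSFiltration A S M r F

/-- `M` has no projective remainder if there is no decomposition `M = N ⊕ P` with `P ≠ 0`
projective and `N` filtrable. -/
def NoProjectiveRemainder (M : Type w₁) [AddCommGroup M] [Module A M] : Prop :=
  ¬ ∃ N P : Submodule A M, IsCompl N P ∧ P ≠ ⊥ ∧ Module.Projective A P ∧ Filtrable A S N

end Filtrations

end StableModule

/-! In the stable category the members of `S` behave like simple modules: Schur's lemma holds modulo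
projective maps. Induction on the number of layers proves more than stated: every stable isomorphism
φ : M → N is congruent, modulo projective maps, to an isomorphism of modules. If all maps from M to
members of `S` are projective, so is the identity of M, and both modules vanish. Otherwise a stably
nonzero map M → S i is, modulo projective maps, a surjection whose kernel has one layer fewer
(`HasLayers.exists_surjective`). The same holds for N, and φ can be made compatible with the two
surjections. The kernels are then stably isomorphic (`isStableIso_restrict`) and have no projective
remainder (`NoProjectiveRemainder.ker`), so by induction they are isomorphic. Since free modules of
finite rank are injective, this isomorphism extends to a map M → N over S i, which is bijective. -/

namespace StableModule

universe u v w w₁ w₂ w₃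

/-! ### Projective maps: closure properties, lifting and extension. -/

section ProjectiveMaps

variable {A : Type v} [Ring A]
  {M : Type w₁} {N : Type w₂} {L : Type w₃}
  [AddCommGroup M] [Module A M] [AddCommGroup N] [Module A N] [AddCommGroup L] [Module A L]

/-- A projective map factors through a finitely generated free module. -/
theorem isProjectiveMap_iff_factors_free {f : M →ₗ[A] N} :
    IsProjectiveMap A f ↔
      ∃ (n : ℕ) (a : M →ₗ[A] (Fin n → A)) (b : (Fin n → A) →ₗ[A] N), f = b ∘ₗ a := by
  constructor
  · rintro ⟨P, _, _, a, b, _, _, rfl⟩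
    obtain ⟨n, p, hp⟩ := Module.Finite.exists_fin' A P
    obtain ⟨s, hs⟩ := Module.projective_lifting_property p LinearMap.id hp
    refine ⟨n, s ∘ₗ a, b ∘ₗ p, ?_⟩
    ext x
    simpa using congrArg b (LinearMap.congr_fun hs (a x)).symm
  · rintro ⟨n, a, b, rfl⟩
    exact ⟨Fin n → A, inferInstance, inferInstance, a, b, inferInstance, inferInstance, rfl⟩

theorem isProjectiveMap_zero : IsProjectiveMap A (0 : M →ₗ[A] N) :=
  isProjectiveMap_iff_factors_free.2 ⟨0, 0, 0, by simp⟩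

theorem IsProjectiveMap.comp_left {f : M →ₗ[A] N} (hf : IsProjectiveMap A f) (g : N →ₗ[A] L) :
    IsProjectiveMap A (g ∘ₗ f) := by
  obtain ⟨P, _, _, a, b, hP, hP', rfl⟩ := hf
  exact ⟨P, inferInstance, inferInstance, a, g ∘ₗ b, hP, hP', rfl⟩

theorem IsProjectiveMap.comp_right {g : N →ₗ[A] L} (hg : IsProjectiveMap A g) (f : M →ₗ[A] N) :
    IsProjectiveMap A (g ∘ₗ f) := by
  obtain ⟨P, _, _, a, b, hP, hP', rfl⟩ := hg
  exact ⟨P, inferInstance, inferInstance, a ∘ₗ f, b, hP, hP', rfl⟩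

theorem IsProjectiveMap.neg {f : M →ₗ[A] N} (hf : IsProjectiveMap A f) :
    IsProjectiveMap A (-f) := by
  simpa using hf.comp_left (-LinearMap.id)

theorem IsProjectiveMap.add {f g : M →ₗ[A] N} (hf : IsProjectiveMap A f)
    (hg : IsProjectiveMap A g) : IsProjectiveMap A (f + g) := by
  obtain ⟨P, _, _, a, b, hP, hP', rfl⟩ := hf
  obtain ⟨Q, _, _, c, d, hQ, hQ', rfl⟩ := hg
  exact ⟨P × Q, inferInstance, inferInstance, a.prod c, b.coprod d, inferInstance,
    inferInstance, by ext x; simp⟩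

theorem IsProjectiveMap.sub {f g : M →ₗ[A] N} (hf : IsProjectiveMap A f)
    (hg : IsProjectiveMap A g) : IsProjectiveMap A (f - g) := by
  simpa [sub_eq_add_neg] using hf.add hg.neg

/-- A projective map lifts, as a projective map, along a surjection. -/
theorem IsProjectiveMap.exists_lift {f : M →ₗ[A] N} (hf : IsProjectiveMap A f)
    {p : L →ₗ[A] N} (hp : Function.Surjective p) :
    ∃ g : M →ₗ[A] L, IsProjectiveMap A g ∧ p ∘ₗ g = f := by
  obtain ⟨P, _, _, a, b, hP, hP', rfl⟩ := hf
  obtain ⟨c, hc⟩ := Module.projective_lifting_property p b hp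
  exact ⟨c ∘ₗ a, ⟨P, inferInstance, inferInstance, a, c, hP, hP', rfl⟩, by
    rw [← LinearMap.comp_assoc, hc]⟩

/-- Over a self-injective ring, a projective map extends, as a projective map, along an
injection. -/
theorem IsProjectiveMap.exists_extend (hA : Module.Injective A A) {f : M →ₗ[A] N}
    (hf : IsProjectiveMap A f) {i : M →ₗ[A] L} (hi : Function.Injective i) :
    ∃ g : L →ₗ[A] N, IsProjectiveMap A g ∧ g ∘ₗ i = f := by
  obtain ⟨n, a, b, rfl⟩ := isProjectiveMap_iff_factors_free.1 hf
  -- Self-injectivity of `A` makes the finite power of `A` injective.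
  obtain ⟨c, hc⟩ := Module.Injective.extension_property A (Fin n → A) M L i hi a
  exact ⟨b ∘ₗ c, isProjectiveMap_iff_factors_free.2 ⟨n, c, b, rfl⟩, by
    rw [LinearMap.comp_assoc, hc]⟩

theorem isProjectiveMap_of_projective [Module.Finite A M] [Module.Projective A M]
    (f : M →ₗ[A] N) : IsProjectiveMap A f := by
  obtain ⟨n, p, hp⟩ := Module.Finite.exists_fin' A M
  obtain ⟨s, hs⟩ := Module.projective_lifting_property p LinearMap.id hp
  refine isProjectiveMap_iff_factors_free.2 ⟨n, s, f ∘ₗ p, ?_⟩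
  rw [LinearMap.comp_assoc, hs, LinearMap.comp_id]

theorem projective_of_isProjectiveMap_id (h : IsProjectiveMap A (LinearMap.id : M →ₗ[A] M)) :
    Module.Projective A M := by
  obtain ⟨P, _, _, a, b, _, _, h⟩ := h
  exact Module.Projective.of_split a b h.symm

end ProjectiveMaps

/-! ### Filtrations refined to single members of `S`. -/

section Layers

variable {A : Type v} [Ring A] {ι : Type u} (S : ι → Type w)
  [∀ i, AddCommGroup (S i)] [∀ i, Module A (S i)]

variable (A) in
/-- `M` is obtained from `0` by `n` successive extensions by members of `S` on top. -/
def HasLayers : ℕ → ∀ (M : Type w₁) [AddCommGroup M] [Module A M], Prop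
  | 0, M, _, _ => Subsingleton M
  | n + 1, M, _, _ => ∃ (i : ι) (f : M →ₗ[A] S i), Function.Surjective f ∧
      HasLayers n (LinearMap.ker f)

variable {S}
variable {M : Type w₁} {N : Type w₂} [AddCommGroup M] [Module A M] [AddCommGroup N] [Module A N]

theorem HasLayers.of_equiv {n : ℕ} (h : HasLayers A S n M) (e : M ≃ₗ[A] N) :
    HasLayers A S n N := by
  induction n generalizing M N with
  | zero => exact @Equiv.subsingleton _ _ e.symm.toEquiv h
  | succ n ih =>
    obtain ⟨i, f, hf, hk⟩ := h
    refine ⟨i, f ∘ₗ e.symm.toLinearMap, hf.comp e.symm.surjective, ih hk ?_⟩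
    exact e.ofSubmodules _ _ (by ext x; simp [Submodule.mem_map_equiv])

/-- An extension of a member of `S` by a module built from `S`, the kernel being given up to an
isomorphism. -/
theorem HasLayers.extend {n : ℕ} {i : ι} (h : HasLayers A S n N) (f : M →ₗ[A] S i)
    (hf : Function.Surjective f) (e : N ≃ₗ[A] LinearMap.ker f) : HasLayers A S (n + 1) M :=
  ⟨i, f, hf, h.of_equiv e⟩

theorem HasLayers.finite (hS : ∀ i, Module.Finite A (S i)) {n : ℕ} (h : HasLayers A S n M) :
    Module.Finite A M := by
  induction n generalizing M with
  | zero => have : Subsingleton M := h; infer_instance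
  | succ n ih =>
    obtain ⟨i, f, hf, hk⟩ := h
    have hK := ih hk
    have := hS i
    refine ⟨Submodule.fg_of_fg_map_of_fg_inf_ker f ?_ ?_⟩
    · rw [Submodule.map_top, LinearMap.range_eq_top.2 hf]
      exact Module.Finite.fg_top
    · rw [top_inf_eq]
      exact Module.Finite.iff_fg.1 hK

/-- If both a kernel and a sum of members of `S` are built from `S`, so is the middle term. -/
theorem HasLayers.of_surjective_pi {n m : ℕ} {t : Fin m → ι} (g : M →ₗ[A] ((j : Fin m) → S (t j)))
    (hg : Function.Surjective g) (h : HasLayers A S n (LinearMap.ker g)) :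
    HasLayers A S (n + m) M := by
  induction m generalizing M with
  | zero =>
    have hk : LinearMap.ker g = ⊤ := by
      rw [LinearMap.ker_eq_top]; ext x j; exact j.elim0
    exact h.of_equiv ((LinearEquiv.ofEq _ _ hk).trans Submodule.topEquiv)
  | succ m ih =>
    let f : M →ₗ[A] S (t 0) := LinearMap.proj 0 ∘ₗ g
    have hf : Function.Surjective f := fun s => by
      obtain ⟨x, hx⟩ := hg (Pi.single 0 s)
      exact ⟨x, by simp [f, hx]⟩
    let g' : LinearMap.ker f →ₗ[A] ((j : Fin m) → S (t j.succ)) :=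
      LinearMap.pi fun j => LinearMap.proj j.succ ∘ₗ g ∘ₗ (LinearMap.ker f).subtype
    have hg' : Function.Surjective g' := fun y => by
      obtain ⟨x, hx⟩ := hg (Fin.cons 0 y)
      refine ⟨⟨x, ?_⟩, ?_⟩
      · simp [f, hx]
      · ext j; simp [g', hx]
    have hk : (LinearMap.ker g').map (LinearMap.ker f).subtype = LinearMap.ker g := by
      ext x
      constructor
      · rintro ⟨⟨y, hy⟩, hy', rfl⟩
        ext j
        refine Fin.cases hy (fun j => ?_) j
        exact congrFun (LinearMap.mem_ker.1 hy') j
      · intro hx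
        have hx : g x = 0 := hx
        exact ⟨⟨x, by simp [f, hx]⟩, by ext j; simp [g', hx], rfl⟩
    -- Peeling off one summand leaves the kernel of `g` unchanged, so each summand costs exactly one
    -- layer.
    refine ⟨t 0, f, hf, ih g' hg' (h.of_equiv ?_)⟩
    exact ((Submodule.equivSubtypeMap _ _).trans (LinearEquiv.ofEq _ _ hk)).symm

/-- Each quotient in `add(S)` is split into its summands, so that later inductions remove one member
of `S` at a time. -/
theorem IsSFiltration.hasLayers {r : ℕ} {F : ℕ → Submodule A M} (h : IsSFiltration A S M r F)
    {i : ℕ} (hi : i ≤ r) : ∃ n, HasLayers A S n (F i) := by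
  induction hi using Nat.decreasingInduction with
  | self => exact ⟨0, by rw [h.bot]; exact inferInstanceAs (Subsingleton (⊥ : Submodule A M))⟩
  | of_succ i hi ih =>
    obtain ⟨n, hn⟩ := ih
    obtain ⟨m, t, ⟨e⟩⟩ := h.layer i hi
    refine ⟨n + m, HasLayers.of_surjective_pi
      (e.toLinearMap ∘ₗ ((F (i + 1)).submoduleOf (F i)).mkQ)
      (e.surjective.comp (Submodule.mkQ_surjective _)) (hn.of_equiv ?_)⟩
    refine (Submodule.submoduleOfEquivOfLe (h.le i hi)).symm.trans (LinearEquiv.ofEq _ _ ?_)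
    rw [LinearEquiv.ker_comp, Submodule.ker_mkQ]

theorem Filtrable.hasLayers (h : Filtrable A S M) : ∃ n, HasLayers A S n M := by
  obtain ⟨r, F, hF⟩ := h
  obtain ⟨n, hn⟩ := hF.hasLayers (Nat.zero_le r)
  exact ⟨n, hn.of_equiv ((LinearEquiv.ofEq _ _ hF.top).trans Submodule.topEquiv)⟩

theorem InAdd.of_equiv (h : InAdd A S M) (e : N ≃ₗ[A] M) : InAdd A S N := by
  obtain ⟨n, t, ⟨e'⟩⟩ := h
  exact ⟨n, t, ⟨e.trans e'⟩⟩

theorem inAdd_self (i : ι) : InAdd A S (S i) :=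
  ⟨1, fun _ => i, ⟨(LinearEquiv.funUnique (Fin 1) A (S i)).symm⟩⟩

theorem HasLayers.filtrable {n : ℕ} (h : HasLayers A S n M) : Filtrable A S M := by
  induction n generalizing M with
  | zero =>
    have : Subsingleton M := h
    exact ⟨0, fun _ => ⊤, rfl, Subsingleton.elim _ _, by simp, by simp⟩
  | succ n ih =>
    obtain ⟨i, f, hf, hk⟩ := h
    obtain ⟨r, F, hF⟩ := ih hk
    let K := LinearMap.ker f
    refine ⟨r + 1, fun j => Nat.casesOn j ⊤ fun j => (F j).map K.subtype, rfl, ?_, ?_, ?_⟩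
    · simp [hF.bot]
    · rintro (_ | j) hj
      · exact le_top
      · exact Submodule.map_mono (hF.le j (by omega))
    · rintro (_ | j) hj
      · refine (inAdd_self i).of_equiv ?_
        refine (Submodule.Quotient.equiv _ K Submodule.topEquiv ?_).trans
          (f.quotKerEquivOfSurjective hf)
        ext x
        simp [hF.top, Submodule.submoduleOf, K]
      · refine (hF.layer j (by omega)).of_equiv ?_
        refine (Submodule.Quotient.equiv _ _ (Submodule.equivSubtypeMap K (F j)) ?_).symm
        ext ⟨x, hx⟩
        obtain ⟨y, hy, rfl⟩ := hx
        simp only [Submodule.submoduleOf, Submodule.mem_map, Submodule.mem_comap]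
        constructor
        · rintro ⟨z, hz, hzy⟩
          exact ⟨z, hz, (Subtype.ext_iff.1 hzy :)⟩
        · rintro ⟨z, hz, hzy⟩
          exact ⟨⟨z, hF.le j (by omega) hz⟩, hz, Subtype.ext hzy⟩

end Layers

/-! ### Maps onto members of `S` and their kernels. -/

section Tops

variable {A : Type v} [Ring A] {ι : Type u} {S : ι → Type w}
  [∀ i, AddCommGroup (S i)] [∀ i, Module A (S i)]
  {M : Type w₁} {N : Type w₂} [AddCommGroup M] [Module A M] [AddCommGroup N] [Module A N]

/-- If every map from `M` to a member of `S` is projective, then so is every map from `M` to a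
module built from `S`. -/
theorem HasLayers.isProjectiveMap {n : ℕ} (h : HasLayers A S n N)
    (hM : ∀ i (f : M →ₗ[A] S i), IsProjectiveMap A f) (g : M →ₗ[A] N) : IsProjectiveMap A g := by
  induction n generalizing N with
  | zero =>
    have : Subsingleton N := h
    rw [Subsingleton.elim g 0]
    exact isProjectiveMap_zero
  | succ n ih =>
    obtain ⟨i, f, hf, hk⟩ := h
    obtain ⟨q, hq, hfq⟩ := (hM i (f ∘ₗ g)).exists_lift hf
    have hmem : ∀ x, (g - q) x ∈ LinearMap.ker f := fun x => by
      simpa [sub_eq_zero] using (LinearMap.congr_fun hfq x).symm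
    have := ((ih hk ((g - q).codRestrict _ hmem)).comp_left (LinearMap.ker f).subtype).add hq
    rwa [LinearMap.subtype_comp_codRestrict, sub_add_cancel] at this

/-- Stable orthogonality in terms of linear maps: every map between members of `S` that is not
projective is, up to a projective map, an isomorphism between equal members. -/
def StablyOrthogonal (A : Type v) [Ring A] (S : ι → Type w) [∀ i, AddCommGroup (S i)]
    [∀ i, Module A (S i)] : Prop :=
  (∀ i j, i ≠ j → ∀ f : S i →ₗ[A] S j, IsProjectiveMap A f) ∧
    ∀ i (f : S i →ₗ[A] S i), ¬ IsProjectiveMap A f →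
      ∃ e : S i ≃ₗ[A] S i, IsProjectiveMap A (f - e.toLinearMap)

/-- A stably nonzero map from a module built from `S` to a member of `S` is, up to a projective
map, a surjection whose kernel is built from `S` with one layer less. -/
theorem HasLayers.exists_surjective (hA : Module.Injective A A) (hS : StablyOrthogonal A S)
    {n : ℕ} (h : HasLayers A S n M) {j : ι} {f : M →ₗ[A] S j} (hf : ¬ IsProjectiveMap A f) :
    ∃ (g : M →ₗ[A] S j) (m : ℕ), Function.Surjective g ∧ IsProjectiveMap A (f - g) ∧
      n = m + 1 ∧ HasLayers A S m (LinearMap.ker g) := by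
  induction n generalizing M with
  | zero =>
    have : Subsingleton M := h
    refine absurd ?_ hf
    rw [show f = 0 by ext x; simp [Subsingleton.elim x 0]]
    exact isProjectiveMap_zero
  | succ n ih =>
    obtain ⟨i, p, hp, hk⟩ := h
    by_cases hfK : IsProjectiveMap A (f ∘ₗ (LinearMap.ker p).subtype)
    -- Modulo `q`, the map kills `ker p` and so factors through the top layer as `h`, to which
    -- stable orthogonality applies.
    · obtain ⟨q, hq, hqf⟩ := hfK.exists_extend hA (LinearMap.ker p).injective_subtype
      have hle : LinearMap.ker p ≤ LinearMap.ker (f - q) := fun x hx => by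
        simpa [sub_eq_zero] using (LinearMap.congr_fun hqf ⟨x, hx⟩).symm
      let h : S i →ₗ[A] S j := (LinearMap.ker p).liftQ (f - q) hle ∘ₗ
        (p.quotKerEquivOfSurjective hp).symm.toLinearMap
      have hh : h ∘ₗ p = f - q := by
        ext x
        have : (p.quotKerEquivOfSurjective hp).symm (p x) = Submodule.Quotient.mk x := by
          rw [LinearEquiv.symm_apply_eq]; rfl
        simp [h, this]
      have hnp : ¬ IsProjectiveMap A h := fun hproj => hf <| by
        have := (hproj.comp_right p).add hq
        rwa [hh, sub_add_cancel] at this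
      obtain rfl : i = j := by
        by_contra hij
        exact hnp (hS.1 i j hij h)
      obtain ⟨e, he⟩ := hS.2 i h hnp
      refine ⟨e.toLinearMap ∘ₗ p, n, e.surjective.comp hp, ?_, rfl, ?_⟩
      · have := (he.comp_right p).add hq
        rw [LinearMap.sub_comp, hh] at this
        convert this using 1
        abel
      · exact hk.of_equiv (LinearEquiv.ofEq _ _ (LinearEquiv.ker_comp _ _).symm)
    -- Here the map is stably nonzero on `ker p`. Once corrected there to a surjection `g'`, its
    -- kernel in `M` still maps onto `S i` under `p`, with `ker g'` underneath: the top layer is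
    -- kept and a lower one is lost.
    · obtain ⟨g', m, hg', hfg, rfl, hm⟩ := ih hk hfK
      obtain ⟨q, hq, hqf⟩ := hfg.exists_extend hA (LinearMap.ker p).injective_subtype
      have hgK : ∀ x : LinearMap.ker p, (f - q) x = g' x := fun x => by
        have := LinearMap.congr_fun hqf x
        simp only [LinearMap.comp_apply, LinearMap.sub_apply, Submodule.subtype_apply] at this ⊢
        rw [this, sub_sub_cancel]
      refine ⟨f - q, m + 1, fun s => ?_, by simpa using hq, rfl, ?_⟩
      · obtain ⟨x, rfl⟩ := hg' s
        exact ⟨x, hgK x⟩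
      · let p' : LinearMap.ker (f - q) →ₗ[A] S i := p ∘ₗ (LinearMap.ker (f - q)).subtype
        have hp' : Function.Surjective p' := fun s => by
          obtain ⟨x, rfl⟩ := hp s
          obtain ⟨y, hy⟩ := hg' ((f - q) x)
          rw [← hgK] at hy
          refine ⟨⟨x - y, ?_⟩, ?_⟩
          · rw [LinearMap.mem_ker, map_sub, hy, sub_self]
          · simp [p']
        refine hm.extend p' hp' ?_
        refine (Submodule.equivSubtypeMap _ _).trans (LinearEquiv.trans (LinearEquiv.ofEq _ _ ?_)
          (Submodule.equivSubtypeMap (LinearMap.ker (f - q)) (LinearMap.ker p')).symm)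
        ext x
        simp only [Submodule.mem_map]
        constructor
        · rintro ⟨y, hy, rfl⟩
          refine ⟨⟨y, ?_⟩, y.2, rfl⟩
          rw [LinearMap.mem_ker, hgK]
          exact hy
        · rintro ⟨y, hy, rfl⟩
          refine ⟨⟨y, hy⟩, ?_, rfl⟩
          rw [LinearMap.mem_ker, ← hgK]
          exact y.2

/-- The decomposition to exclude is 0 ⊕ M, the zero module being filtrable. -/
theorem NoProjectiveRemainder.subsingleton (h : NoProjectiveRemainder A S M)
    (hM : IsProjectiveMap A (LinearMap.id : M →ₗ[A] M)) : Subsingleton M := by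
  by_contra hne
  rw [not_subsingleton_iff_nontrivial] at hne
  have := projective_of_isProjectiveMap_id hM
  refine h ⟨⊥, ⊤, isCompl_bot_top, top_ne_bot, Module.Projective.of_equiv Submodule.topEquiv.symm,
    HasLayers.filtrable (n := 0) ?_⟩
  exact inferInstanceAs (Subsingleton (⊥ : Submodule A M))

/-- The kernel of a surjection onto a member of `S` inherits the absence of a projective
remainder, since projective modules are injective. -/
theorem NoProjectiveRemainder.ker (hA : Module.Injective A A) [IsNoetherianRing A]
    [Module.Finite A M] (h : NoProjectiveRemainder A S M) {i : ι} {f : M →ₗ[A] S i}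
    (hf : Function.Surjective f) : NoProjectiveRemainder A S (LinearMap.ker f) := by
  rintro ⟨N, P, hNP, hP, hPproj, hN⟩
  obtain ⟨n, hn⟩ := hN.hasLayers
  let K := LinearMap.ker f
  let π : K →ₗ[A] P := P.projectionOnto N hNP.symm
  -- The projection onto `P` extends to `M`, so `P` splits off `M` too; the complement will be an
  -- extension of `S i` by `N`, contradicting `h`.
  obtain ⟨r, -, hr⟩ := (isProjectiveMap_of_projective (LinearMap.id : P →ₗ[A] P)).comp_right π
    |>.exists_extend hA K.injective_subtype
  have hrK : ∀ x : K, r x = π x := fun x => LinearMap.congr_fun hr x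
  let P' : Submodule A M := P.map K.subtype
  let eP : P ≃ₗ[A] P' := Submodule.equivSubtypeMap K P
  let ρ : M →ₗ[A] P' := eP.toLinearMap ∘ₗ r
  have hρ : ∀ x : P', ρ x = x := by
    rintro ⟨_, y, hy, rfl⟩
    have : π y = ⟨y, hy⟩ := Submodule.projectionOnto_apply_left hNP.symm ⟨y, hy⟩
    simp only [ρ, LinearMap.comp_apply, Submodule.subtype_apply, hrK, this]
    rfl
  have hkerρ : ∀ x, ρ x = 0 ↔ r x = 0 := fun x => by simp [ρ]
  refine h ⟨LinearMap.ker ρ, P', (LinearMap.isCompl_of_proj hρ).symm, ?_,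
    Module.Projective.of_equiv eP, ?_⟩
  · intro hbot
    exact hP (Submodule.map_injective_of_injective K.injective_subtype (by simpa [P'] using hbot))
  · refine HasLayers.filtrable (n := n + 1) ?_
    let f' : LinearMap.ker ρ →ₗ[A] S i := f ∘ₗ (LinearMap.ker ρ).subtype
    refine hn.extend f' (fun s => ?_) ?_
    · obtain ⟨x, rfl⟩ := hf s
      -- `ρ` takes values in `P' ≤ ker f`, so this correction does not change `f x`.
      refine ⟨⟨x - ρ x, by simp [hρ]⟩, ?_⟩
      obtain ⟨y, -, hy⟩ := (ρ x).2
      have : f (ρ x) = 0 := by rw [← hy]; exact y.2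
      simp [f', this]
    · refine (Submodule.equivSubtypeMap _ _).trans (LinearEquiv.trans (LinearEquiv.ofEq _ _ ?_)
        (Submodule.equivSubtypeMap (LinearMap.ker ρ) (LinearMap.ker f')).symm)
      have hπ : ∀ x, π x = 0 ↔ x ∈ N := fun x => Submodule.projectionOnto_apply_eq_zero_iff hNP.symm
      ext x
      simp only [Submodule.mem_map]
      constructor
      · rintro ⟨y, hy, rfl⟩
        refine ⟨⟨y, ?_⟩, y.2, rfl⟩
        rw [LinearMap.mem_ker, hkerρ, hrK, hπ]
        exact hy
      · rintro ⟨⟨x, hx⟩, hy, rfl⟩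
        refine ⟨⟨x, hy⟩, ?_, rfl⟩
        rw [← hπ, ← hrK, ← hkerρ]
        exact hx

end Tops

/-! ### Stable isomorphisms on the level of linear maps. -/

section StableIso

variable {A : Type v} [Ring A] {M : Type w₁} {N : Type w₂} {L : Type w₃}
  [AddCommGroup M] [Module A M] [AddCommGroup N] [Module A N] [AddCommGroup L] [Module A L]

/-- A linear map that becomes an isomorphism in the stable category. -/
def IsStableIso (φ : M →ₗ[A] N) : Prop :=
  ∃ ψ : N →ₗ[A] M, IsProjectiveMap A (ψ ∘ₗ φ - LinearMap.id) ∧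
    IsProjectiveMap A (φ ∘ₗ ψ - LinearMap.id)

/-- A linear map with a stable left inverse and a stable right inverse is a stable
isomorphism. -/
theorem IsStableIso.of_left_right {φ : M →ₗ[A] N} {ψ χ : N →ₗ[A] M}
    (hψ : IsProjectiveMap A (ψ ∘ₗ φ - LinearMap.id))
    (hχ : IsProjectiveMap A (φ ∘ₗ χ - LinearMap.id)) : IsStableIso φ := by
  refine ⟨ψ, hψ, ?_⟩
  -- This difference is φψ − φχ.
  have h := ((hψ.comp_right χ).comp_left φ).sub ((hχ.comp_left ψ).comp_left φ)
  convert h.add hχ using 1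
  ext x
  simp

/-- If `f' ∘ φ` and `f` agree stably and `f'` is surjective, then `φ` may be changed by a
projective map so that they agree. -/
theorem exists_strictify {f : M →ₗ[A] L} {f' : N →ₗ[A] L} (hf' : Function.Surjective f')
    {φ : M →ₗ[A] N} (h : IsProjectiveMap A (f' ∘ₗ φ - f)) :
    ∃ φ' : M →ₗ[A] N, IsProjectiveMap A (φ' - φ) ∧ f' ∘ₗ φ' = f := by
  obtain ⟨q, hq, hfq⟩ := h.exists_lift hf'
  exact ⟨φ - q, by simpa using hq.neg, by rw [LinearMap.comp_sub, hfq, sub_sub_cancel]⟩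

/-- The restriction to `ker f` of an endomorphism over `f` that is stably the identity is stably
unipotent. -/
theorem exists_stable_inverse_restrict {f : M →ₗ[A] L} {α : M →ₗ[A] M}
    (hα : IsProjectiveMap A (α - LinearMap.id)) (hfα : f ∘ₗ α = f)
    {β : LinearMap.ker f →ₗ[A] LinearMap.ker f}
    (hβ : ∀ x, (β x : M) = α x) :
    IsProjectiveMap A (β ∘ₗ ((2 : ℕ) • LinearMap.id - β) - LinearMap.id) ∧
      IsProjectiveMap A (((2 : ℕ) • LinearMap.id - β) ∘ₗ β - LinearMap.id) := by
  -- `β - 1` is only known to be projective as a map into `M`, but its square is `h ∘ (α - 1)` on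
  -- the kernel and hence projective. So `2 - β = 1 - (β - 1)` inverts `β` stably.
  let h : M →ₗ[A] LinearMap.ker f := (α - LinearMap.id).codRestrict _ fun x => by
    simpa [sub_eq_zero] using LinearMap.congr_fun hfα x
  have hh : ∀ x, (h x : M) = α x - x := fun x => rfl
  have hproj : IsProjectiveMap A (h ∘ₗ (α - LinearMap.id) ∘ₗ (LinearMap.ker f).subtype) :=
    (hα.comp_right _).comp_left h
  constructor <;>
  · convert hproj.neg using 1
    ext x
    simp [hh, hβ, two_smul]
    abel

end StableIso

/-! ### Lifting stable isomorphisms to module isomorphisms. -/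

section Main

variable {A : Type v} [Ring A] {ι : Type u} {S : ι → Type w}
  [∀ i, AddCommGroup (S i)] [∀ i, Module A (S i)]

/-- A stable isomorphism over `L`, compatible in both directions, restricts to a stable
isomorphism of the kernels. -/
theorem isStableIso_restrict {M : Type w₁} {N : Type w₂} {L : Type w₃}
    [AddCommGroup M] [Module A M] [AddCommGroup N] [Module A N] [AddCommGroup L] [Module A L]
    {f : M →ₗ[A] L} {g : N →ₗ[A] L} {φ : M →ₗ[A] N} {ψ : N →ₗ[A] M}
    (hφ : g ∘ₗ φ = f) (hψ : f ∘ₗ ψ = g)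
    (h₁ : IsProjectiveMap A (ψ ∘ₗ φ - LinearMap.id))
    (h₂ : IsProjectiveMap A (φ ∘ₗ ψ - LinearMap.id))
    {φK : LinearMap.ker f →ₗ[A] LinearMap.ker g} (hφK : ∀ x, (φK x : N) = φ x) :
    IsStableIso φK := by
  let ψK : LinearMap.ker g →ₗ[A] LinearMap.ker f :=
    (ψ ∘ₗ (LinearMap.ker g).subtype).codRestrict _ fun x => by
      simpa using (LinearMap.congr_fun hψ x).trans x.2
  have hψK : ∀ x, (ψK x : M) = ψ x := fun x => rfl
  have h₃ := (exists_stable_inverse_restrict (f := f) h₁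
    (by rw [← LinearMap.comp_assoc, hψ, hφ]) (β := ψK ∘ₗ φK) (fun x => by simp [hψK, hφK])).2
  have h₄ := (exists_stable_inverse_restrict (f := g) h₂
    (by rw [← LinearMap.comp_assoc, hφ, hψ]) (β := φK ∘ₗ ψK) (fun x => by simp [hψK, hφK])).1
  exact IsStableIso.of_left_right (ψ := ((2 : ℕ) • LinearMap.id - ψK ∘ₗ φK) ∘ₗ ψK)
    (χ := ψK ∘ₗ ((2 : ℕ) • LinearMap.id - φK ∘ₗ ψK)) h₃ h₄

/-- A map over `L` between two modules surjecting onto `L` is bijective if it is so on kernels. -/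
theorem bijective_of_bijective_ker {M : Type w₁} {N : Type w₂} {L : Type w₃}
    [AddCommGroup M] [Module A M] [AddCommGroup N] [Module A N] [AddCommGroup L] [Module A L]
    {f : M →ₗ[A] L} {g : N →ₗ[A] L} (hf : Function.Surjective f) {φ : M →ₗ[A] N}
    (hφ : g ∘ₗ φ = f) (e : LinearMap.ker f ≃ₗ[A] LinearMap.ker g)
    (he : ∀ x, (e x : N) = φ x) : Function.Bijective φ := by
  have hφ' : ∀ x, g (φ x) = f x := fun x => LinearMap.congr_fun hφ x
  constructor
  · rw [injective_iff_map_eq_zero]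
    intro x hx
    have hxk : x ∈ LinearMap.ker f := by rw [LinearMap.mem_ker, ← hφ', hx, map_zero]
    have : e ⟨x, hxk⟩ = 0 := Subtype.ext ((he _).trans hx)
    exact congrArg Subtype.val ((LinearEquiv.map_eq_zero_iff e).1 this)
  · intro y
    obtain ⟨x, hx⟩ := hf (g y)
    obtain ⟨z, hz⟩ := e.surjective ⟨y - φ x, by rw [LinearMap.mem_ker, map_sub, hφ', hx, sub_self]⟩
    refine ⟨x + z, ?_⟩
    rw [map_add, ← he, hz]
    simp

/-- Every stable isomorphism between modules built from `S` without projective remainder is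
represented by an isomorphism of modules. -/
theorem IsStableIso.exists_linearEquiv (hA : Module.Injective A A) [IsNoetherianRing A]
    (hfin : ∀ i, Module.Finite A (S i)) (hS : StablyOrthogonal A S) {n n' : ℕ}
    {M : Type w₁} {N : Type w₂} [AddCommGroup M] [Module A M] [AddCommGroup N] [Module A N]
    (hM : HasLayers A S n M) (hM' : NoProjectiveRemainder A S M)
    (hN : HasLayers A S n' N) (hN' : NoProjectiveRemainder A S N)
    {φ : M →ₗ[A] N} (hφ : IsStableIso φ) :
    ∃ e : M ≃ₗ[A] N, IsProjectiveMap A (e.toLinearMap - φ) := by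
  induction n using Nat.strong_induction_on generalizing n' M N with
  | _ n ih =>
  obtain ⟨ψ, h₁, h₂⟩ := hφ
  by_cases htop : ∀ i (f : M →ₗ[A] S i), IsProjectiveMap A f
  · have := hM'.subsingleton (hM.isProjectiveMap htop LinearMap.id)
    have hφ0 : φ = 0 := by ext x; simp [Subsingleton.elim x 0]
    have := hN'.subsingleton (by simpa [hφ0] using h₂.neg)
    refine ⟨⟨0, 0, fun _ => Subsingleton.elim _ _, fun _ => Subsingleton.elim _ _⟩, ?_⟩
    rw [Subsingleton.elim (_ - φ) 0]
    exact isProjectiveMap_zero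
  · push Not at htop
    obtain ⟨i, f₀, hf₀⟩ := htop
    obtain ⟨f, m, hf, hf₀f, rfl, hm⟩ := hM.exists_surjective hA hS hf₀
    have hfnp : ¬ IsProjectiveMap A f := fun h => hf₀ (by simpa using hf₀f.add h)
    have hgnp : ¬ IsProjectiveMap A (f ∘ₗ ψ) := fun h => hfnp <| by
      convert (h.comp_right φ).sub (h₁.comp_left f) using 1
      ext x
      simp
    obtain ⟨g, m', hg, hfg, rfl, hm'⟩ := hN.exists_surjective hA hS hgnp
    obtain ⟨ψ', hψψ', hψ'⟩ := exists_strictify hf hfg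
    have hgφ : IsProjectiveMap A (g ∘ₗ φ - f) := by
      convert (h₁.comp_left f).sub (hfg.comp_right φ) using 1
      ext x
      simp
    obtain ⟨φ', hφφ', hφ'⟩ := exists_strictify hg hgφ
    have h₁' : IsProjectiveMap A (ψ' ∘ₗ φ' - LinearMap.id) := by
      convert (h₁.add (hψψ'.comp_right φ')).add (hφφ'.comp_left ψ) using 1
      ext x
      simp
      abel
    have h₂' : IsProjectiveMap A (φ' ∘ₗ ψ' - LinearMap.id) := by
      convert (h₂.add (hφφ'.comp_right ψ')).add (hψψ'.comp_left φ) using 1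
      ext x
      simp
      abel
    let φK : LinearMap.ker f →ₗ[A] LinearMap.ker g :=
      (φ' ∘ₗ (LinearMap.ker f).subtype).codRestrict _ fun x => by
        simpa using (LinearMap.congr_fun hφ' x).trans x.2
    have := hM.finite hfin
    have := hN.finite hfin
    obtain ⟨e, he⟩ := ih m (Nat.lt_succ_self m) hm (hM'.ker hA hf) hm' (hN'.ker hA hg)
      (isStableIso_restrict hφ' hψ' h₁' h₂' (φK := φK) fun _ => rfl)
    obtain ⟨q, hq, hqe⟩ := he.exists_extend hA (LinearMap.ker f).injective_subtype
    -- `q` extends the projective difference between `e` and `φK` with values in `ker g`, so `θ`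
    -- restricts to `e` and stays compatible with `f` and `g`.
    let θ : M →ₗ[A] N := φ' + (LinearMap.ker g).subtype ∘ₗ q
    have hθ : g ∘ₗ θ = f := by
      rw [← hφ']
      ext x
      simp [θ]
    have heθ : ∀ x, (e x : N) = θ x := fun x => by
      have : q x = e x - φK x := LinearMap.congr_fun hqe x
      simp [θ, this, φK]
    refine ⟨LinearEquiv.ofBijective θ (bijective_of_bijective_ker hf hθ e heθ), ?_⟩
    convert hφφ'.add (hq.comp_left (LinearMap.ker g).subtype) using 1
    ext x
    simp [θ]
    abel

/-- One-dimensional stable endomorphism spaces and vanishing of the other stable homomorphism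
spaces give stable orthogonality. -/
theorem stablyOrthogonal_of_stableHom (k : Type w₁) [Field k] [Algebra k A]
    [∀ i, Module k (S i)] [∀ i, IsScalarTower k A (S i)]
    (hend : ∀ i, Nonempty (StableHom k A (S i) (S i) ≃ₗ[k] k))
    (hhom : ∀ i j, i ≠ j → ∀ φ : StableHom k A (S i) (S j), φ = 0) : StablyOrthogonal A S := by
  refine ⟨fun i j hij f => ?_, fun i f hf => ?_⟩
  · exact (Submodule.Quotient.mk_eq_zero (projectiveMaps k A (S i) (S j))).1
      (hhom i j hij (Submodule.Quotient.mk f))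
  · obtain ⟨d⟩ := hend i
    let π := (projectiveMaps k A (S i) (S i)).mkQ
    have hπ : ∀ g, π g = 0 ↔ IsProjectiveMap A g := fun g => by
      rw [← LinearMap.mem_ker, Submodule.ker_mkQ]
      rfl
    have hid : d (π LinearMap.id) ≠ 0 := fun h => by
      rw [LinearEquiv.map_eq_zero_iff, hπ] at h
      exact hf (by simpa using h.comp_left f)
    have hfd : d (π f) ≠ 0 := fun h => by
      rw [LinearEquiv.map_eq_zero_iff, hπ] at h
      exact hf h
    -- The stable endomorphism space is a line spanned by the identity, so `f` is stably this
    -- nonzero scalar.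
    let c : kˣ := Units.mk0 (d (π f) / d (π LinearMap.id)) (div_ne_zero hfd hid)
    let e : S i ≃ₗ[A] S i := DistribMulAction.toLinearEquiv A (S i) c
    have he : e.toLinearMap = (c : k) • LinearMap.id := by ext x; rfl
    refine ⟨e, (hπ _).1 (d.injective ?_)⟩
    rw [he, map_sub, map_sub, map_smul, map_smul, map_zero, smul_eq_mul, Units.val_mk0,
      div_mul_cancel₀ _ hid, sub_self]

/-- A stable isomorphism is represented by a linear map that is a stable isomorphism. -/
theorem StablyIsomorphic.exists_isStableIso {k : Type w₃} [Field k] [Algebra k A]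
    {M : Type w₁} {N : Type w₂}
    [AddCommGroup M] [Module k M] [Module A M] [IsScalarTower k A M]
    [AddCommGroup N] [Module k N] [Module A N] [IsScalarTower k A N]
    (h : StablyIsomorphic k A M N) : ∃ φ : M →ₗ[A] N, IsStableIso φ := by
  obtain ⟨φ, ψ, h₁, h₂⟩ := h
  obtain ⟨φ, rfl⟩ := Submodule.Quotient.mk_surjective _ φ
  obtain ⟨ψ, rfl⟩ := Submodule.Quotient.mk_surjective _ ψ
  exact ⟨φ, ψ, (Submodule.Quotient.eq (projectiveMaps k A M M)).1 h₁,
    (Submodule.Quotient.eq (projectiveMaps k A N N)).1 h₂⟩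

end Main

end StableModule

theorem mainTheorem10
    (k : Type*) (A : Type*) [Field k] [Ring A] [Algebra k A]
    -- `A` is a finite dimensional self-injective `k`-algebra
    [Module.Finite k A] (hA : Module.Injective A A)
    -- `S` is a finite family of finitely generated indecomposable `A`-modules
    {ι : Type*} [Finite ι] (S : ι → Type*) [∀ i, AddCommGroup (S i)] [∀ i, Module k (S i)]
    [∀ i, Module A (S i)] [∀ i, IsScalarTower k A (S i)]
    (hfin : ∀ i, Module.Finite A (S i))
    (hind : ∀ i, StableModule.IsIndecomposable A (S i))
    -- stable homomorphism spaces: `k` from a member to itself, `0` between different members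
    (hend : ∀ i, Nonempty (StableModule.StableHom k A (S i) (S i) ≃ₗ[k] k))
    (hhom : ∀ i j, i ≠ j → ∀ φ : StableModule.StableHom k A (S i) (S j), φ = 0)
    (M₁ : Type*) [AddCommGroup M₁] [Module k M₁] [Module A M₁] [IsScalarTower k A M₁]
    (M₂ : Type*) [AddCommGroup M₂] [Module k M₂] [Module A M₂] [IsScalarTower k A M₂]
    (hM₁ : StableModule.Filtrable A S M₁) (hM₁' : StableModule.NoProjectiveRemainder A S M₁)
    (hM₂ : StableModule.Filtrable A S M₂) (hM₂' : StableModule.NoProjectiveRemainder A S M₂)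
    (h : StableModule.StablyIsomorphic k A M₁ M₂) :
    Nonempty (M₁ ≃ₗ[A] M₂) := by
  have : IsNoetherianRing A := isNoetherian_of_tower k inferInstance
  obtain ⟨n₁, h₁⟩ := hM₁.hasLayers
  obtain ⟨n₂, h₂⟩ := hM₂.hasLayers
  obtain ⟨φ, hφ⟩ := h.exists_isStableIso
  obtain ⟨e, -⟩ := hφ.exists_linearEquiv hA hfin
    (StableModule.stablyOrthogonal_of_stableHom k hend hhom) h₁ hM₁' h₂ hM₂'
  exact ⟨e⟩
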